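/- Conventions. $\mathcal H^k$ is the $k$-dimensional Hausdorff measure on $\mathbb R^d$, normalized to agree with Lebesgue measure on $\mathbb R^k$. Let $\Sigma$ be a simplex soup, i.e. a finite family of (nondegenerate) simplices of $\mathbb R^d$; $d_\sigma$ is the dimension of $\sigma\in\Sigma$, $\sigma^0$ the linear subspace tangent to $\sigma$, $\Pi_{\sigma^0}:\mathbb R^d\to\sigma^0$ the orthogonal projection, and $K=\bigcup_{\sigma\in\Sigma}\sigma$. A simplicial measure on $\Sigma$ with densities $\rho_\sigma\ge 0$ is a measure $\mu$ with $\mu(B)=\sum_{\sigma\in\Sigma}\int_{B\cap\sigma}\rho_\sigma\,d\mathcal H^{d_\sigma}$ for all Borel $B\subseteq\mathbb R^d$. It is regular if (i) $d_\sigma\ge 2$ for every $\sigma\in\Sigma$; (ii) every $\rho_\sigma:\sigma\to\mathbb R$ is continuous with $\min_\sigma\rho_\sigma>0$; (iii) $K\setminus F$ is connected (in particular non-empty) for every finite $F\subseteq K$. Points $y_1,\dots,y_N\in\mathbb R^d$ are generic with respect to $\Sigma$ if for every $\sigma=[x_0,\dots,x_k]\in\Sigma$, all $p\in\{1,\dots,k\}$,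 $\ell\in\{1,\dots,\min(d,N-1)\}$, all distinct $i_0,\dots,i_\ell\in\{1,\dots,N\}$ and all distinct $j_0,\dots,j_p\in\{0,\dots,k\}$, $$\dim\bigl(\{y_{i_1}-y_{i_0},\dots,y_{i_\ell}-y_{i_0}\}^\perp\cap\mathrm{span}(x_{j_1}-x_{j_0},\dots,x_{j_p}-x_{j_0})\bigr)=\max(p-\ell,0).$$ For $\psi\in\mathbb R^N$ let $\mathrm{Lag}_i(\psi)=\{x\in K:\ \|x-y_i\|^2+\psi_i\le\|x-y_j\|^2+\psi_j\ \text{for all } j\}$, $\mathrm{Lag}_{i,j}(\psi)=\mathrm{Lag}_i(\psi)\cap\mathrm{Lag}_j(\psi)$, and $G(\psi)=(\mu(\mathrm{Lag}_i(\psi)))_{1\le i\le N}$. Theorem. Let $\mu$ be a regular simplicial measure on a simplex soup $\Sigma$ with densities $(\rho_\sigma)_{\sigma\in\Sigma}$ and let $y_1,\dots,y_N$ be generic with respect to $\Sigma$. Then $\mu$ is finite, $G:\mathbb R^N\to\mathbb R^N$ is of class $C^1$ on all of $\mathbb R^N$, and for every $\psi\in\mathbb R^N$ $$\frac{\partial G_i}{\partial\psi_j}(\psi)=\sum_{\sigma\in\Sigma}\frac{1}{2\,\|\Pi_{\sigma^0}(y_i-y_j)\|}\int_{\mathrm{Lag}_{i,j}(\psi)\cap\sigma}\rho_\sigma\,d\mathcal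 H^{d_\sigma-1}\qquad(i\ne j),$$ where the projections $\Pi_{\sigma^0}(y_i-y_j)$ are non-zero and the integrals converge, and $$\frac{\partial G_i}{\partial\psi_i}(\psi)=-\sum_{j\ne i}\frac{\partial G_i}{\partial\psi_j}(\psi)\qquad\text{for every } i.$$ -/

import Mathlib

open MeasureTheory Set

noncomputable section

namespace SemiDiscrete

/-- The Euclidean space `ℝ^d`. -/
abbrev Space (d : ℕ) : Type := EuclideanSpace ℝ (Fin d)

/-- A simplex soup: a family of nondegenerate simplices of `ℝ^d`, of possibly different dimensions,
indexed by `ι` (a finite type wherever it is used). -/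
structure SimplexSoup (ι : Type*) (d : ℕ) where
  /-- The dimension of each simplex. -/
  dim : ι → ℕ
  /-- The simplices, given by affinely independent vertices. -/
  simplex : ∀ a : ι, Affine.Simplex ℝ (Space d) (dim a)

namespace SimplexSoup

variable {ι : Type*} {d : ℕ}

/-- The simplex with index `a` as a set: the convex hull of its vertices. -/
def body (S : SimplexSoup ι d) (a : ι) : Set (Space d) :=
  convexHull ℝ (range (S.simplex a).points)

/-- The support of the soup: the union of its simplices. -/
def support (S : SimplexSoup ι d) : Set (Space d) := ⋃ a, S.body a

/-- The linear space tangent to the simplex with index `a`. -/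
def tangent (S : SimplexSoup ι d) (a : ι) : Submodule ℝ (Space d) :=
  vectorSpan ℝ (range (S.simplex a).points)

end SimplexSoup

/-- `μ` is the simplicial measure on the soup `S` with densities `ρ a` with respect to the
`dim a`-dimensional Hausdorff measure on the simplex `a`. Here `μHE[k]` is the `k`-dimensional
Hausdorff measure, normalized to agree with Lebesgue measure on `ℝ^k`.
The values of `ρ a` outside the simplex `a` play no role. -/
structure IsSimplicialMeasure {ι : Type*} [Fintype ι] {d : ℕ} (S : SimplexSoup ι d)
    (ρ : ι → Space d → ℝ) (μ : Measure (Space d)) : Prop where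
  density_measurable : ∀ a, AEMeasurable (ρ a) ((μHE[S.dim a]).restrict (S.body a))
  density_nonneg : ∀ a, ∀ x ∈ S.body a, 0 ≤ ρ a x
  apply_eq : ∀ B : Set (Space d), MeasurableSet B →
    μ B = ∑ a, ∫⁻ x in B ∩ S.body a, ENNReal.ofReal (ρ a x) ∂μHE[S.dim a]

/-- Regular simplicial measures. -/
structure IsRegularSimplicialMeasure {ι : Type*} [Fintype ι] {d : ℕ} (S : SimplexSoup ι d)
    (ρ : ι → Space d → ℝ) (μ : Measure (Space d)) : Prop
    extends IsSimplicialMeasure S ρ μ where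
  two_le_dim : ∀ a, 2 ≤ S.dim a
  density_continuous : ∀ a, ContinuousOn (ρ a) (S.body a)
  /-- The minimum of `ρ a` over the simplex is positive. -/
  density_min_pos : ∀ a, ∃ m : ℝ, IsLeast (ρ a '' S.body a) m ∧ 0 < m
  connected_diff : ∀ F : Set (Space d), F.Finite → F ⊆ S.support → IsConnected (S.support \ F)

/-- The points `y` are in generic position with respect to the `k`-dimensional simplex with
vertices `x 0, …, x k`. The subtraction `p - ℓ` is truncated, i.e. it is `max (p - ℓ) 0`. -/
def IsGenericSimplex {d N k : ℕ} (y : Fin N → Space d) (x : Fin (k + 1) → Space d) : Prop :=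
  ∀ p : ℕ, 1 ≤ p → p ≤ k → ∀ ℓ : ℕ, 1 ≤ ℓ → ℓ ≤ min d (N - 1) →
    ∀ (i : Fin (ℓ + 1) ↪ Fin N) (j : Fin (p + 1) ↪ Fin (k + 1)),
      Module.finrank ℝ
        ((Submodule.span ℝ (range fun m : Fin ℓ => y (i m.succ) - y (i 0)))ᗮ ⊓
          Submodule.span ℝ (range fun m : Fin p => x (j m.succ) - x (j 0)) :
          Submodule ℝ (Space d)) = p - ℓ

/-- The points `y` are in generic position with respect to the simplex soup `S`. -/
def IsGeneric {ι : Type*} {d N : ℕ} (y : Fin N → Space d) (S : SimplexSoup ι d) : Prop :=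
  ∀ a, IsGenericSimplex y (S.simplex a).points

/-- The power cell of `y i` for the weights `ψ`. -/
def powerCell {d N : ℕ} (y : Fin N → Space d) (ψ : Fin N → ℝ) (i : Fin N) : Set (Space d) :=
  {x | ∀ j, ‖x - y i‖ ^ 2 + ψ i ≤ ‖x - y j‖ ^ 2 + ψ j}

/-- The Laguerre cell `Lag_i(ψ)`: the part of the power cell inside the support of the soup. -/
def lag {ι : Type*} {d N : ℕ} (S : SimplexSoup ι d) (y : Fin N → Space d) (ψ : Fin N → ℝ)
    (i : Fin N) : Set (Space d) :=
  powerCell y ψ i ∩ S.support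

/-- The interface `Lag_{i,j}(ψ)` between two Laguerre cells. -/
def lagInter {ι : Type*} {d N : ℕ} (S : SimplexSoup ι d) (y : Fin N → Space d) (ψ : Fin N → ℝ)
    (i j : Fin N) : Set (Space d) :=
  lag S y ψ i ∩ lag S y ψ j

/-- The map `G(ψ) = (μ(Lag_i(ψ)))_i`. -/
def massMap {ι : Type*} {d N : ℕ} (S : SimplexSoup ι d) (μ : Measure (Space d))
    (y : Fin N → Space d) (ψ : Fin N → ℝ) : Fin N → ℝ :=
  fun i => (μ (lag S y ψ i)).toReal

/-- The sum over the simplices `σ` of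
`1 / (2 ‖Π_{σ⁰}(y_i - y_j)‖) * ∫_{Lag_{i,j}(ψ) ∩ σ} ρ_σ dH^{d_σ - 1}`. -/
def interfaceMass {ι : Type*} [Fintype ι] {d N : ℕ} (S : SimplexSoup ι d) (ρ : ι → Space d → ℝ)
    (y : Fin N → Space d) (ψ : Fin N → ℝ) (i j : Fin N) : ℝ :=
  ∑ a, 1 / (2 * ‖(S.tangent a).starProjection (y i - y j)‖) *
    ∫ x in lagInter S y ψ i j ∩ S.body a, ρ a x ∂μHE[S.dim a - 1]

end SemiDiscrete

end

/-! Parametrize each simplex isometrically by the linear space tangent to it. In this chart a power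
cell is a polyhedron `{v | ∀ l, ⟪n l, v⟫ ≤ t l}` whose normals `n l` are fixed; the weights only
enter the thresholds of the bisectors, as `ψ j - ψ i` plus a constant.

By Fubini in the slices orthogonal to `n j`, the integral of the density over the polyhedron has a
derivative with respect to `t j`, equal to the integral over the face with index `j` divided by
`‖n j‖`. A bisector has `n j = 2 • Π (y j - y i)`, hence the factor in the formula. The face is in
turn a polyhedron in a hyperplane, cut out by half-spaces which are nondegenerate because genericity
keeps the other normals from being parallel to `n j`. Almost every point of the hyperplane therefore
lies off the boundaries of these half-spaces, and dominated convergence makes the integral over the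
face continuous in `t`. Continuous partial derivatives give a continuous Fréchet derivative. Since
the thresholds depend on differences of weights, each `j ≠ i` contributes its interface integral to
the derivative along `ψ j` and the opposite to the derivative along `ψ i`. -/

noncomputable section

namespace SemiDiscrete

open Filter Topology
open scoped RealInnerProductSpace

section PartialDerivatives

variable {𝕜 J F : Type*} [RCLike 𝕜] [DecidableEq J]
  {E : J → Type*} [∀ j, NormedAddCommGroup (E j)] [∀ j, NormedSpace 𝕜 (E j)]
  [NormedAddCommGroup F] [NormedSpace 𝕜 F]
  {f : (∀ j, E j) → F} {f' : ∀ j, (∀ i, E i) → E j →L[𝕜] F}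

theorem hasFDerivAt_piecewise_of_continuous_partials [Finite J]
    (hf : ∀ x j, HasFDerivAt (fun t => f (Function.update x j t)) (f' j x) (x j))
    (hf' : ∀ j, Continuous (f' j)) (s : Finset J) (y x : ∀ j, E j) :
    HasFDerivAt (fun z => f (s.piecewise z y))
      (∑ j ∈ s, (f' j (s.piecewise x y)).comp (ContinuousLinearMap.proj j)) x := by
  have := Fintype.ofFinite J
  -- Freeing one more coordinate at a time reduces the claim to functions of two variables.
  induction s using Finset.induction_on generalizing y x with
  | empty => simpa using hasFDerivAt_const (f y) x
  | insert j s hj ih =>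
    have piecewise_insert (z : ∀ j, E j) :
        (insert j s).piecewise z y = s.piecewise z (Function.update y j (z j)) := by
      rw [Finset.piecewise_insert, s.update_piecewise_of_notMem _ _ hj]
    have continuous_piecewise :
        Continuous fun p : (∀ j, E j) × E j => s.piecewise p.1 (Function.update y j p.2) :=
      continuous_pi fun i => by
        by_cases hi : i ∈ s
        · simp only [s.piecewise_eq_of_mem _ _ hi]
          fun_prop
        · simp only [s.piecewise_eq_of_notMem _ _ hi]
          fun_prop
    have hpartial (p : (∀ j, E j) × E j) :
        HasFDerivAt (fun r => f (s.piecewise p.1 (Function.update y j r)))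
          (f' j (s.piecewise p.1 (Function.update y j p.2))) p.2 := by
      simpa [← s.update_piecewise_of_notMem _ _ hj] using
        hf (s.piecewise p.1 (Function.update y j p.2)) j
    have hjoint : HasFDerivAt
        (fun p : (∀ j, E j) × E j => f (s.piecewise p.1 (Function.update y j p.2))) _ (x, x j) :=
      (hasStrictFDerivAt_uncurry_coprod
        (f := fun z r => f (s.piecewise z (Function.update y j r)))
        (f₁ := fun z r => ∑ i ∈ s, (f' i (s.piecewise z (Function.update y j r))).comp
          (ContinuousLinearMap.proj i))
        (f₂ := fun z r => f' j (s.piecewise z (Function.update y j r)))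
        (.of_forall fun p => ih (Function.update y j p.2) p.1) (.of_forall hpartial)
        (continuous_finsetSum _ fun i _ =>
          ((hf' i).comp continuous_piecewise).clm_comp continuous_const).continuousAt
        ((hf' j).comp continuous_piecewise).continuousAt).hasFDerivAt
    simp only [piecewise_insert, Finset.sum_insert hj]
    refine (hjoint.comp x ((ContinuousLinearMap.id 𝕜 (∀ j, E j)).prod
      (ContinuousLinearMap.proj j)).hasFDerivAt).congr_fderiv ?_
    ext v
    simp [Function.HasUncurry.uncurry, add_comm]

theorem hasFDerivAt_of_continuous_partials [Fintype J]
    (hf : ∀ x j, HasFDerivAt (fun t => f (Function.update x j t)) (f' j x) (x j))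
    (hf' : ∀ j, Continuous (f' j)) (x : ∀ j, E j) :
    HasFDerivAt f (∑ j, (f' j x).comp (ContinuousLinearMap.proj j)) x := by
  simpa using hasFDerivAt_piecewise_of_continuous_partials hf hf' Finset.univ x x

end PartialDerivatives

section IsometricImages

variable {X Y E : Type*} [MetricSpace X] [MeasurableSpace X] [BorelSpace X]
  [MetricSpace Y] [MeasurableSpace Y] [BorelSpace Y] [NormedAddCommGroup E] {e : X → Y}

theorem restrict_image_euclideanHausdorffMeasure (he : Isometry e) (m : ℕ) (A : Set X) :
    (μHE[m]).restrict (e '' A) = ((μHE[m] : Measure X).map e).restrict (e '' A) := by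
  rw [he.map_euclideanHausdorffMeasure,
    Measure.restrict_restrict_of_subset (image_subset_range e A)]

variable [CompleteSpace X]

theorem setIntegral_image_euclideanHausdorffMeasure [NormedSpace ℝ E] (he : Isometry e) (m : ℕ)
    (f : Y → E) (A : Set X) : ∫ y in e '' A, f y ∂μHE[m] = ∫ x in A, f (e x) ∂μHE[m] := by
  rw [restrict_image_euclideanHausdorffMeasure he,
    he.isClosedEmbedding.measurableEmbedding.setIntegral_map, he.injective.preimage_image]

theorem integrableOn_image_euclideanHausdorffMeasure (he : Isometry e) (m : ℕ) (f : Y → E)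
    (A : Set X) : IntegrableOn f (e '' A) μHE[m] ↔ IntegrableOn (f ∘ e) A μHE[m] := by
  rw [IntegrableOn, restrict_image_euclideanHausdorffMeasure he, ← IntegrableOn,
    he.isClosedEmbedding.measurableEmbedding.integrableOn_map_iff, he.injective.preimage_image]

end IsometricImages

section Hyperplanes

variable {V E : Type*} [NormedAddCommGroup V] [InnerProductSpace ℝ V]
  [NormedAddCommGroup E] {n : V}

/-- The affine hyperplane with normal `n` on which `⟪n, ·⟫` takes the value `r`. -/
def hyperplane (n : V) (r : ℝ) : Set V := {v | ⟪n, v⟫ = r}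

/-- The isometric parametrization of `hyperplane n r` by the orthogonal complement of `n ≠ 0`. -/
def hyperplanePoint (n : V) (r : ℝ) (z : (ℝ ∙ n)ᗮ) : V := (r / ‖n‖ ^ 2) • n + z

theorem inner_hyperplanePoint (hn : n ≠ 0) (r : ℝ) (z : (ℝ ∙ n)ᗮ) :
    ⟪n, hyperplanePoint n r z⟫ = r := by
  have hz : ⟪n, (z : V)⟫ = 0 := z.2 n (Submodule.mem_span_singleton_self n)
  rw [hyperplanePoint, inner_add_right, inner_smul_right, hz, real_inner_self_eq_norm_sq, add_zero,
    div_mul_cancel₀ _ (by positivity)]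

theorem isometry_hyperplanePoint (n : V) (r : ℝ) : Isometry (hyperplanePoint n r) :=
  Isometry.of_dist_eq fun z w => by simp [hyperplanePoint, Subtype.dist_eq]

theorem continuous_hyperplanePoint (n : V) :
    Continuous fun p : ℝ × (ℝ ∙ n)ᗮ => hyperplanePoint n p.1 p.2 := by
  unfold hyperplanePoint
  fun_prop

theorem range_hyperplanePoint (hn : n ≠ 0) (r : ℝ) :
    range (hyperplanePoint n r) = hyperplane n r := by
  refine Subset.antisymm (range_subset_iff.2 (inner_hyperplanePoint hn r)) fun v hv => ?_
  have hz : v - (r / ‖n‖ ^ 2) • n ∈ (ℝ ∙ n)ᗮ := by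
    rw [Submodule.mem_orthogonal_singleton_iff_inner_right, inner_sub_right, inner_smul_right,
      real_inner_self_eq_norm_sq, div_mul_cancel₀ _ (by positivity), hv, sub_self]
  exact ⟨⟨_, hz⟩, by simp [hyperplanePoint]⟩

theorem norm_le_norm_hyperplanePoint (n : V) (r : ℝ) (z : (ℝ ∙ n)ᗮ) :
    ‖z‖ ≤ ‖hyperplanePoint n r z‖ := by
  have horth : ⟪(r / ‖n‖ ^ 2) • n, (z : V)⟫ = 0 := by
    rw [inner_smul_left, z.2 n (Submodule.mem_span_singleton_self n), mul_zero]
  have hpyth := norm_add_sq_eq_norm_sq_add_norm_sq_real horth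
  rw [Submodule.coe_norm, hyperplanePoint]
  refine le_of_sq_le_sq ?_ (norm_nonneg _)
  nlinarith [norm_nonneg ((r / ‖n‖ ^ 2) • n)]

variable [FiniteDimensional ℝ V]

theorem finrank_orthogonal_singleton (hn : n ≠ 0) :
    Module.finrank ℝ (ℝ ∙ n)ᗮ = Module.finrank ℝ V - 1 := by
  have h := (ℝ ∙ n).finrank_add_finrank_orthogonal
  rw [finrank_span_singleton hn] at h
  omega

variable [MeasurableSpace V] [BorelSpace V]

theorem volume_hyperplane (hn : n ≠ 0) (r : ℝ) : volume (hyperplane n r) = 0 := by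
  rcases eq_empty_or_nonempty (hyperplane n r) with h | ⟨v, hv⟩
  · simp [h]
  have heq : hyperplane n r = AffineSubspace.mk' v (ℝ ∙ n)ᗮ := by
    ext w
    rw [SetLike.mem_coe, AffineSubspace.mem_mk', vsub_eq_sub,
      Submodule.mem_orthogonal_singleton_iff_inner_right, inner_sub_right, sub_eq_zero,
      show ⟪n, v⟫ = r from hv]
    rfl
  rw [heq]
  refine Measure.addHaar_affineSubspace _ _ fun htop => hn ?_
  have hdir := congrArg AffineSubspace.direction htop
  rwa [AffineSubspace.direction_mk', AffineSubspace.direction_top,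
    Submodule.orthogonal_eq_top_iff, Submodule.span_singleton_eq_bot] at hdir

theorem setIntegral_hyperplane [NormedSpace ℝ E] (hn : n ≠ 0) (r : ℝ) (f : V → E) :
    ∫ v in hyperplane n r, f v ∂μHE[Module.finrank ℝ V - 1] = ∫ z, f (hyperplanePoint n r z) := by
  rw [← range_hyperplanePoint hn, ← image_univ,
    setIntegral_image_euclideanHausdorffMeasure (isometry_hyperplanePoint n r),
    Measure.restrict_univ, ← finrank_orthogonal_singleton hn,
    InnerProductSpace.euclideanHausdorffMeasure_eq_volume]

theorem measurePreserving_hyperplanePoint (hn : n ≠ 0) :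
    MeasurePreserving (fun p : ℝ × (ℝ ∙ n)ᗮ => hyperplanePoint n p.1 p.2)
      ((‖‖n‖⁻¹‖ₑ • (volume : Measure ℝ)).prod volume) volume := by
  -- Normalized so that `⟪n, r • u⟫ = r`.
  let u : (ℝ ∙ n) := (‖n‖ ^ 2)⁻¹ • ⟨n, Submodule.mem_span_singleton_self n⟩
  have hline : MeasurePreserving (fun r : ℝ => r • u) (‖‖n‖⁻¹‖ₑ • volume) volume := by
    have hu₀ : u ≠ 0 := smul_ne_zero (by positivity) (by simpa using hn)
    have hu : ‖u‖ = ‖n‖⁻¹ := by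
      rw [norm_smul, Submodule.coe_norm, norm_inv, norm_pow, norm_norm]
      field_simp
    refine ⟨by fun_prop, ?_⟩
    rw [Measure.map_smul, ← hu, enorm_norm]
    exact (volume_eq_of_finrank_eq_one (finrank_span_singleton hn) hu₀).symm
  have hprod := (ℝ ∙ n).measurePreserving_measurableEquivProd (0 : V) |>.symm
  rw [InnerProductSpace.euclideanHausdorffMeasure_eq_volume] at hprod
  convert! hprod.comp (hline.prod (MeasurePreserving.id (volume : Measure (ℝ ∙ n)ᗮ))) using 1
  ext p
  simp [hyperplanePoint, u, div_eq_mul_inv, mul_smul]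

theorem measurableEmbedding_hyperplanePoint (hn : n ≠ 0) :
    MeasurableEmbedding fun p : ℝ × (ℝ ∙ n)ᗮ => hyperplanePoint n p.1 p.2 := by
  refine (continuous_hyperplanePoint n).measurable.measurableEmbedding fun p q h => ?_
  have hr : p.1 = q.1 := by
    simpa only [inner_hyperplanePoint hn] using congrArg (fun v => ⟪n, v⟫) h
  exact Prod.ext hr ((isometry_hyperplanePoint n q.1).injective (by simpa only [hr] using h))

theorem integrable_hyperplanePoint (hn : n ≠ 0) {f : V → E} (hf : Integrable f) :
    Integrable (fun p : ℝ × (ℝ ∙ n)ᗮ => f (hyperplanePoint n p.1 p.2))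
      ((‖‖n‖⁻¹‖ₑ • (volume : Measure ℝ)).prod volume) :=
  ((measurePreserving_hyperplanePoint hn).integrable_comp_emb
    (measurableEmbedding_hyperplanePoint hn)).2 hf

theorem integrable_setIntegral_hyperplane [NormedSpace ℝ E] (hn : n ≠ 0) {f : V → E}
    (hf : Integrable f) :
    Integrable fun r => ∫ v in hyperplane n r, f v ∂μHE[Module.finrank ℝ V - 1] := by
  simp only [setIntegral_hyperplane hn]
  exact (integrable_smul_measure (by simpa using hn) (by simp)).1
    (integrable_hyperplanePoint hn hf).integral_prod_left

theorem integral_eq_integral_hyperplane [NormedSpace ℝ E] (hn : n ≠ 0) {f : V → E}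
    (hf : Integrable f) :
    ∫ v, f v = ‖n‖⁻¹ • ∫ r, ∫ v in hyperplane n r, f v ∂μHE[Module.finrank ℝ V - 1] := by
  rw [← (measurePreserving_hyperplanePoint hn).integral_comp
    (measurableEmbedding_hyperplanePoint hn), integral_prod _ (integrable_hyperplanePoint hn hf),
    integral_smul_measure]
  simp [setIntegral_hyperplane hn]

theorem exists_integrable_bound_hyperplanePoint {g : V → E} (hg : Continuous g)
    (hgs : HasCompactSupport g) (v : V) : ∃ bound : (ℝ ∙ v)ᗮ → ℝ, Integrable bound ∧
      ∀ r z, ‖g (hyperplanePoint v r z)‖ ≤ bound z := by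
  obtain ⟨C, hC⟩ := hgs.exists_bound_of_continuous hg
  obtain ⟨R, hR⟩ := hgs.isCompact.isBounded.subset_closedBall 0
  refine ⟨(Metric.closedBall 0 R).indicator fun _ => C,
    (integrable_indicator_iff measurableSet_closedBall).2
      (integrableOn_const (isCompact_closedBall _ _).measure_ne_top), fun r z => ?_⟩
  by_cases hz : z ∈ Metric.closedBall 0 R
  · rw [indicator_of_mem hz]
    exact hC _
  · rw [indicator_of_notMem hz, norm_le_zero_iff]
    refine image_eq_zero_of_notMem_tsupport fun h => hz ?_
    rw [mem_closedBall_zero_iff]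
    exact (norm_le_norm_hyperplanePoint v r z).trans (mem_closedBall_zero_iff.1 (hR h))

theorem integrableOn_hyperplane {g : V → E} (hg : Continuous g) (hgs : HasCompactSupport g) {v : V}
    (hv : v ≠ 0) (r : ℝ) : IntegrableOn g (hyperplane v r) μHE[Module.finrank ℝ V - 1] := by
  obtain ⟨bound, hbound, hle⟩ := exists_integrable_bound_hyperplanePoint hg hgs v
  rw [← range_hyperplanePoint hv, ← image_univ,
    integrableOn_image_euclideanHausdorffMeasure (isometry_hyperplanePoint v r), integrableOn_univ,
    ← finrank_orthogonal_singleton hv, InnerProductSpace.euclideanHausdorffMeasure_eq_volume]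
  exact hbound.mono' (hg.comp (isometry_hyperplanePoint v r).continuous).aestronglyMeasurable
    (.of_forall (hle r))

end Hyperplanes

section Polyhedra

variable {V I : Type*} [NormedAddCommGroup V] [InnerProductSpace ℝ V] {n : I → V} {t : I → ℝ}

/-- The polyhedron cut out by the half-spaces `⟪n l, v⟫ ≤ t l`. -/
def polyhedron (n : I → V) (t : I → ℝ) : Set V := {v | ∀ l, ⟪n l, v⟫ ≤ t l}

/-- The part of `polyhedron n t` on the boundary of its half-space with index `j`. -/
def face (n : I → V) (t : I → ℝ) (j : I) : Set V := polyhedron n t ∩ hyperplane (n j) (t j)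

theorem isClosed_polyhedron (n : I → V) (t : I → ℝ) : IsClosed (polyhedron n t) := by
  simp only [polyhedron, ofPred_forall]
  exact isClosed_iInter fun l => isClosed_le (by fun_prop) (by fun_prop)

theorem eventually_mem_polyhedron_iff [Finite I] {v : V} (hv : ∀ l, v ∉ hyperplane (n l) (t l)) :
    ∀ᶠ u in 𝓝 t, v ∈ polyhedron n u ↔ v ∈ polyhedron n t := by
  have hl (l : I) : ∀ᶠ u : I → ℝ in 𝓝 t, ⟪n l, v⟫ ≤ u l ↔ ⟪n l, v⟫ ≤ t l := by
    have hu : Tendsto (fun u : I → ℝ => u l) (𝓝 t) (𝓝 (t l)) := (continuous_apply l).continuousAt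
    rcases lt_or_gt_of_ne (hv l) with h | h
    · filter_upwards [hu.eventually_const_lt h] with u hu using iff_of_true hu.le h.le
    · filter_upwards [hu.eventually_lt_const h] with u hu using iff_of_false hu.not_ge h.not_ge
  filter_upwards [eventually_all.2 hl] with u hu using forall_congr' hu

theorem preimage_hyperplanePoint_face {j : I} (hj : n j ≠ 0) (t : I → ℝ) :
    hyperplanePoint (n j) (t j) ⁻¹' face n t j =
      polyhedron (fun l : {l // l ≠ j} => (ℝ ∙ n j)ᗮ.orthogonalProjectionOnto (n l))
        (fun l => t l - t j / ‖n j‖ ^ 2 * ⟪n l, n j⟫) := by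
  ext z
  have hinner (l : I) : ⟪n l, hyperplanePoint (n j) (t j) z⟫ =
      t j / ‖n j‖ ^ 2 * ⟪n l, n j⟫ + ⟪(ℝ ∙ n j)ᗮ.orthogonalProjectionOnto (n l), z⟫ := by
    rw [hyperplanePoint, inner_add_right, inner_smul_right,
      Submodule.inner_orthogonalProjectionOnto_eq_of_mem_right]
  have hmem := inner_hyperplanePoint hj (t j) z
  simp only [face, polyhedron, hyperplane, mem_preimage, mem_inter_iff, mem_ofPred_eq, hmem,
    and_true, Subtype.forall, le_sub_iff_add_le']
  refine forall_congr' fun l => ?_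
  rcases eq_or_ne l j with rfl | hl
  · simp [hmem]
  · simp [hinner, hl]

theorem mem_polyhedron_update_iff [DecidableEq I] {v : V} {j : I} {r : ℝ} :
    v ∈ polyhedron n (Function.update t j r) ↔ ⟪n j, v⟫ ≤ r ∧ ∀ l ≠ j, ⟪n l, v⟫ ≤ t l := by
  refine ⟨fun h => ⟨by simpa using h j, fun l hl => by simpa [hl] using h l⟩, fun h l => ?_⟩
  rcases eq_or_ne l j with rfl | hl
  · simpa using h.1
  · simpa [hl] using h.2 l hl

theorem polyhedron_update_inter_hyperplane [DecidableEq I] (n : I → V) (t : I → ℝ) (j : I)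
    (r s : ℝ) :
    polyhedron n (Function.update t j s) ∩ hyperplane (n j) r =
      if r ≤ s then face n (Function.update t j r) j else ∅ := by
  ext v
  split_ifs with hr
  · simp only [face, mem_inter_iff, mem_polyhedron_update_iff, Function.update_self]
    exact and_congr_left fun hv => by simp [show ⟪n j, v⟫ = r from hv, hr]
  · simp only [mem_inter_iff, mem_polyhedron_update_iff, mem_empty_iff_false, iff_false]
    rintro ⟨⟨hle, -⟩, hv⟩
    exact hr (hv ▸ hle)

section Integrals

variable [MeasurableSpace V] [BorelSpace V] {E : Type*} [NormedAddCommGroup E] [NormedSpace ℝ E]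
  {g : V → E} {j : I}

/-- The integral of `g` over a face of `polyhedron n t`, with respect to the Hausdorff measure of
codimension one. -/
def faceIntegral (n : I → V) (g : V → E) (j : I) (t : I → ℝ) : E :=
  ∫ v in face n t j, g v ∂μHE[Module.finrank ℝ V - 1]

theorem setIntegral_hyperplane_indicator_polyhedron [DecidableEq I] (n : I → V) (g : V → E)
    (t : I → ℝ) (j : I) (s : ℝ) :
    (fun r => ∫ v in hyperplane (n j) r, (polyhedron n (Function.update t j s)).indicator g v
        ∂μHE[Module.finrank ℝ V - 1]) =
      (Iic s).indicator fun r => faceIntegral n g j (Function.update t j r) := by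
  ext r
  rw [setIntegral_indicator (isClosed_polyhedron _ _).measurableSet, inter_comm,
    polyhedron_update_inter_hyperplane]
  by_cases hr : r ≤ s <;> simp [hr, faceIntegral]

variable [FiniteDimensional ℝ V]

theorem continuous_setIntegral_polyhedron [Finite I] (hn : ∀ l, n l ≠ 0)
    {T : Type*} [TopologicalSpace T] [FirstCountableTopology T] {τ : T → I → ℝ}
    (hτ : Continuous τ) {F : T → V → E} {bound : V → ℝ}
    (hF_meas : ∀ p, AEStronglyMeasurable (F p)) (hF_bound : ∀ p v, ‖F p v‖ ≤ bound v)
    (hbound : Integrable bound) (hF_cont : ∀ v, Continuous fun p => F p v) :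
    Continuous fun p => ∫ v in polyhedron n (τ p), F p v := by
  have hmeas (p : T) := (isClosed_polyhedron n (τ p)).measurableSet
  simp only [← integral_indicator (hmeas _)]
  refine continuous_iff_continuousAt.2 fun p₀ => continuousAt_of_dominated
    (.of_forall fun p => (hF_meas p).indicator (hmeas p))
    (.of_forall fun p => .of_forall fun v => (norm_indicator_le_norm_self _ _).trans (hF_bound p v))
    hbound ?_
  have hgeneric : ∀ᵐ v : V, ∀ l, v ∉ hyperplane (n l) (τ p₀ l) :=
    ae_all_iff.2 fun l => measure_eq_zero_iff_ae_notMem.1 (volume_hyperplane (hn l) _)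
  filter_upwards [hgeneric] with v hv
  have hmem := hτ.continuousAt.eventually (eventually_mem_polyhedron_iff hv)
  by_cases hv₀ : v ∈ polyhedron n (τ p₀)
  · refine (hF_cont v).continuousAt.congr ?_
    filter_upwards [hmem] with p hp using (indicator_of_mem (hp.2 hv₀) _).symm
  · refine continuousAt_const.congr (f := fun _ => 0) ?_
    filter_upwards [hmem] with p hp using (indicator_of_notMem (mt hp.1 hv₀) _).symm

theorem faceIntegral_eq_setIntegral_polyhedron (hj : n j ≠ 0) (g : V → E) (t : I → ℝ) :
    faceIntegral n g j t =
      ∫ z in polyhedron (fun l : {l // l ≠ j} => (ℝ ∙ n j)ᗮ.orthogonalProjectionOnto (n l))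
        (fun l => t l - t j / ‖n j‖ ^ 2 * ⟪n l, n j⟫), g (hyperplanePoint (n j) (t j) z) := by
  rw [faceIntegral, ← preimage_hyperplanePoint_face hj, ← finrank_orthogonal_singleton hj,
    ← InnerProductSpace.euclideanHausdorffMeasure_eq_volume,
    ← setIntegral_image_euclideanHausdorffMeasure (isometry_hyperplanePoint (n j) (t j)) _ g,
    image_preimage_eq_of_subset]
  rw [range_hyperplanePoint hj]
  exact inter_subset_right

theorem continuous_faceIntegral [Finite I] (hg : Continuous g) (hgs : HasCompactSupport g)
    (hj : n j ≠ 0) (hnj : ∀ l ≠ j, n l ∉ ℝ ∙ n j) : Continuous (faceIntegral n g j) := by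
  obtain ⟨bound, hbound, hle⟩ := exists_integrable_bound_hyperplanePoint hg hgs (n j)
  simp only [funext (faceIntegral_eq_setIntegral_polyhedron hj g)]
  have hcoord : Continuous fun p : (I → ℝ) × (ℝ ∙ n j)ᗮ => (p.1 j, p.2) := by fun_prop
  have hpoint := (continuous_hyperplanePoint (n j)).comp hcoord
  have hthreshold : Continuous fun (t : I → ℝ) (l : {l // l ≠ j}) =>
      t l - t j / ‖n j‖ ^ 2 * ⟪n l, n j⟫ := by fun_prop
  refine continuous_setIntegral_polyhedron (fun l => ?_) hthreshold
    (fun t => (hg.comp (isometry_hyperplanePoint _ _).continuous).aestronglyMeasurable)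
    (fun t => hle (t j)) hbound (fun z => hg.comp (hpoint.comp (.prodMk_left z)))
  rw [Ne, Submodule.orthogonalProjectionOnto_eq_zero_iff, Submodule.orthogonal_orthogonal]
  exact hnj l l.2

theorem integrableOn_Iic_faceIntegral [DecidableEq I] (hj : n j ≠ 0) (hg : Integrable g)
    (t : I → ℝ) (s : ℝ) :
    IntegrableOn (fun r => faceIntegral n g j (Function.update t j r)) (Iic s) := by
  rw [← integrable_indicator_iff measurableSet_Iic, ← setIntegral_hyperplane_indicator_polyhedron]
  exact integrable_setIntegral_hyperplane hj (hg.indicator (isClosed_polyhedron _ _).measurableSet)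

theorem setIntegral_polyhedron_update [DecidableEq I] (hj : n j ≠ 0) (hg : Integrable g)
    (t : I → ℝ) (s : ℝ) :
    ∫ v in polyhedron n (Function.update t j s), g v =
      ‖n j‖⁻¹ • ∫ r in Iic s, faceIntegral n g j (Function.update t j r) := by
  have hm := (isClosed_polyhedron n (Function.update t j s)).measurableSet
  rw [← integral_indicator hm, integral_eq_integral_hyperplane hj (hg.indicator hm),
    setIntegral_hyperplane_indicator_polyhedron, integral_indicator measurableSet_Iic]

theorem hasDerivAt_setIntegral_Iic [CompleteSpace E] {h : ℝ → E} (hc : Continuous h)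
    (hint : ∀ s, IntegrableOn h (Iic s)) (s : ℝ) :
    HasDerivAt (fun s => ∫ r in Iic s, h r) (h s) s := by
  have hsplit : (fun s => ∫ r in Iic s, h r) =
      fun s => (∫ r in Iic 0, h r) + ∫ r in (0 : ℝ)..s, h r := by
    ext s
    rw [← intervalIntegral.integral_Iic_sub_Iic (hint 0) (hint s), add_sub_cancel]
  rw [hsplit]
  exact (hc.integral_hasStrictDerivAt 0 s).hasDerivAt.const_add _

theorem hasDerivAt_setIntegral_polyhedron [Finite I] [DecidableEq I] [CompleteSpace E]
    (hg : Continuous g) (hgs : HasCompactSupport g) (hj : n j ≠ 0) (hnj : ∀ l ≠ j, n l ∉ ℝ ∙ n j)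
    (t : I → ℝ) :
    HasDerivAt (fun s => ∫ v in polyhedron n (Function.update t j s), g v)
      (‖n j‖⁻¹ • faceIntegral n g j t) (t j) := by
  have hgi : Integrable g := hg.integrable_of_hasCompactSupport hgs
  simp only [setIntegral_polyhedron_update hj hgi t]
  have hcont : Continuous fun r => faceIntegral n g j (Function.update t j r) :=
    (continuous_faceIntegral hg hgs hj hnj).comp (continuous_const.update j continuous_id)
  simpa only [Function.update_eq_self] using (hasDerivAt_setIntegral_Iic hcont
    (integrableOn_Iic_faceIntegral hj hgi t) (t j)).fun_const_smul ‖n j‖⁻¹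

theorem hasFDerivAt_setIntegral_polyhedron_sumElim {J K : Type*} [Fintype J] [Finite K]
    [CompleteSpace E] {n : J ⊕ K → V} (hg : Continuous g) (hgs : HasCompactSupport g)
    (hn : ∀ j, n (.inl j) ≠ 0) (hnl : ∀ j, ∀ l ≠ .inl j, n l ∉ ℝ ∙ n (.inl j)) (β : K → ℝ)
    (τ : J → ℝ) :
    HasFDerivAt (fun τ => ∫ v in polyhedron n (Sum.elim τ β), g v)
      (∑ j, (ContinuousLinearMap.proj (R := ℝ) j).smulRight
        (‖n (.inl j)‖⁻¹ • faceIntegral n g (.inl j) (Sum.elim τ β))) τ := by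
  classical
  have hpartial (τ : J → ℝ) (j : J) :=
    hasDerivAt_setIntegral_polyhedron hg hgs (hn j) (hnl j) (Sum.elim τ β)
  simp only [Sum.update_elim_inl] at hpartial
  have helim : Continuous fun τ : J → ℝ => Sum.elim τ β := by
    refine continuous_pi fun l => ?_
    rcases l with l | l
    exacts [continuous_apply l, continuous_const]
  have hcont (j : J) : Continuous fun τ : J → ℝ =>
      ‖n (.inl j)‖⁻¹ • faceIntegral n g (.inl j) (Sum.elim τ β) :=
    ((continuous_faceIntegral hg hgs (hn j) (hnl j)).comp helim).const_smul _
  refine (hasFDerivAt_of_continuous_partials (fun τ j => (hpartial τ j).hasFDerivAt) (fun j => ?_)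
    τ).congr_fderiv ?_
  · exact (ContinuousLinearMap.toSpanSingletonCLE (𝕜 := ℝ)).continuous.comp (hcont j)
  · ext v
    simp

end Integrals

end Polyhedra

theorem exists_hasCompactSupport_eqOn {X : Type*} [TopologicalSpace X] [T2Space X] [NormalSpace X]
    [LocallyCompactSpace X] {K : Set X} (hK : IsCompact K) {f : X → ℝ} (hf : ContinuousOn f K) :
    ∃ g : X → ℝ, Continuous g ∧ HasCompactSupport g ∧ EqOn g f K := by
  obtain ⟨g, hg⟩ := ContinuousMap.exists_restrict_eq hK.isClosed
    ⟨K.domRestrict f, continuousOn_iff_continuous_domRestrict.1 hf⟩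
  obtain ⟨χ, hχ_one, -, hχ_supp, -⟩ := exists_continuous_one_zero_of_isCompact hK isClosed_empty
    (disjoint_empty K)
  refine ⟨fun x => χ x * g x, by fun_prop, hχ_supp.mul_right, fun x hx => ?_⟩
  have hgx : g x = f x := congrArg (fun F : C(K, ℝ) => F ⟨x, hx⟩) hg
  simp [hχ_one hx, hgx]

section Simplices

variable {V : Type*} [NormedAddCommGroup V] [InnerProductSpace ℝ V] {k : ℕ}
  (s : Affine.Simplex ℝ V k)

/-- The direction of the affine span of a simplex. -/
abbrev direction : Submodule ℝ V := vectorSpan ℝ (range s.points)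

theorem finrank_direction : Module.finrank ℝ (direction s) = k :=
  s.independent.finrank_vectorSpan (Fintype.card_fin _)

/-- The isometric parametrization of the affine span of a simplex by its direction, with the first
vertex as the origin. -/
def chart : direction s →ᵃⁱ[ℝ] V :=
  (AffineIsometryEquiv.vaddConst ℝ (s.points 0)).toAffineIsometry.comp
    (direction s).subtypeₗᵢ.toAffineIsometry

theorem chart_apply (v : direction s) : chart s v = v + s.points 0 := rfl

/-- The vertices of a simplex, as an affine basis of its chart. -/
def chartBasis : AffineBasis (Fin (k + 1)) ℝ (direction s) :=
  have hindep : AffineIndependent ℝ fun m => (⟨s.points m - s.points 0,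
      vsub_mem_vectorSpan ℝ ⟨m, rfl⟩ ⟨0, rfl⟩⟩ : direction s) := by
    refine AffineIndependent.of_comp (chart s).toAffineMap ?_
    convert! s.independent using 1
    ext m
    simp [chart_apply]
  { toFun := _
    ind' := hindep
    tot' := hindep.affineSpan_eq_top_iff_card_eq_finrank_add_one.2 (by
      rw [finrank_direction, Fintype.card_fin]) }

theorem coe_chartBasis (m : Fin (k + 1)) : (chartBasis s m : V) = s.points m - s.points 0 := rfl

theorem chart_comp_chartBasis : chart s ∘ chartBasis s = s.points := by
  ext m
  simp [chart_apply, coe_chartBasis]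

/-- The outward normal of the facet of a simplex opposite to the vertex `f`, in the chart of the
simplex: minus the gradient of the barycentric coordinate with index `f`. -/
def facetNormal (f : Fin (k + 1)) : direction s :=
  -(InnerProductSpace.toDual ℝ _).symm
    (LinearMap.toContinuousLinearMap ((chartBasis s).coord f).linear)

theorem inner_facetNormal (f : Fin (k + 1)) (v : direction s) :
    ⟪facetNormal s f, v⟫ = (chartBasis s).coord f 0 - (chartBasis s).coord f v := by
  rw [facetNormal, inner_neg_left, InnerProductSpace.toDual_symm_apply,
    LinearMap.coe_toContinuousLinearMap', AffineMap.decomp' ((chartBasis s).coord f)]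
  simp

theorem convexHull_eq_image_chart :
    convexHull ℝ (range s.points) =
      chart s '' polyhedron (facetNormal s) fun f => (chartBasis s).coord f 0 := by
  have hpoly : polyhedron (facetNormal s) (fun f => (chartBasis s).coord f 0) =
      convexHull ℝ (range (chartBasis s)) := by
    rw [AffineBasis.convexHull_eq_nonneg_coord]
    simp only [polyhedron, inner_facetNormal, sub_le_self_iff]
  rw [hpoly, ← (chart s).coe_toAffineMap, AffineMap.image_convexHull, (chart s).coe_toAffineMap,
    ← range_comp, chart_comp_chartBasis]

variable {s}

theorem facetNormal_ne_zero {f m : Fin (k + 1)} (hm : m ≠ f) : facetNormal s f ≠ 0 := by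
  intro h
  have hf := inner_facetNormal s f (chartBasis s f)
  have hm' := inner_facetNormal s f (chartBasis s m)
  rw [h, inner_zero_left, AffineBasis.coord_apply] at hf hm'
  simp only [hm.symm, ↓reduceIte, sub_zero] at hf hm'
  linarith

theorem inner_facetNormal_eq_zero {f : Fin (k + 1)} {v : direction s}
    (hv : (v : V) ∈ vectorSpan ℝ (s.points '' {f}ᶜ)) : ⟪facetNormal s f, v⟫ = 0 := by
  have hle : vectorSpan ℝ (s.points '' {f}ᶜ) ≤
      (LinearMap.ker (innerₗ _ (facetNormal s f))).map (direction s).subtype := by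
    refine Submodule.span_le.2 ?_
    rintro _ ⟨_, ⟨a, ha, rfl⟩, _, ⟨b, hb, rfl⟩, rfl⟩
    refine ⟨chartBasis s a - chartBasis s b, ?_, by simp [coe_chartBasis]⟩
    rw [SetLike.mem_coe, LinearMap.mem_ker, innerₗ_apply_apply, inner_sub_right, inner_facetNormal,
      inner_facetNormal, AffineBasis.coord_apply_ne _ (Ne.symm ha),
      AffineBasis.coord_apply_ne _ (Ne.symm hb), sub_self]
  obtain ⟨w, hw, hwv⟩ := hle hv
  rwa [← Subtype.ext hwv]

variable [MeasurableSpace V] [BorelSpace V]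

variable (s) in
theorem euclideanHausdorffMeasure_direction :
    (μHE[k] : Measure (direction s)) = volume := by
  rw [← InnerProductSpace.euclideanHausdorffMeasure_eq_volume, finrank_direction]

theorem integrableOn_convexHull {E : Type*}
    [NormedAddCommGroup E] {f : V → E} (hf : ContinuousOn f (convexHull ℝ (range s.points))) :
    IntegrableOn f (convexHull ℝ (range s.points)) μHE[k] := by
  have hchart := (chart s).isometry
  have hcompact := hchart.isClosedEmbedding.isCompact_preimage
    ((finite_range s.points).isCompact_convexHull ℝ)
  rw [convexHull_eq_image_chart] at hf hcompact ⊢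
  rw [hchart.injective.preimage_image] at hcompact
  rw [integrableOn_image_euclideanHausdorffMeasure hchart, euclideanHausdorffMeasure_direction]
  exact (hf.comp hchart.continuous.continuousOn (mapsTo_image _ _)).integrableOn_compact hcompact

end Simplices

section Transversality

variable {V J : Type*} [NormedAddCommGroup V] [InnerProductSpace ℝ V] {k : ℕ}

/-- The bisectors of the points `y` meet the simplex `s` transversally: no bisector is parallel to
a facet of `s`, and the traces on the affine span of `s` of two bisectors with a common site are not
parallel. -/
structure IsTransverse (y : J → V) (s : Affine.Simplex ℝ V k) : Prop where
  notMem_orthogonal_facet : ∀ f i j, i ≠ j → y j - y i ∉ (vectorSpan ℝ (s.points '' {f}ᶜ))ᗮ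
  notMem_orthogonal_direction : ∀ i j l, i ≠ j → i ≠ l → j ≠ l → ∀ r : ℝ,
    y l - y i - r • (y j - y i) ∉ (direction s)ᗮ

variable {d N : ℕ} {y : Fin N → Space d} {s : Affine.Simplex ℝ (Space d) k}

theorem span_range_succ_sub_zero {n : ℕ} (p : Fin (n + 1) → V) :
    Submodule.span ℝ (range fun m : Fin n => p m.succ - p 0) = vectorSpan ℝ (range p) := by
  rw [vectorSpan_range_eq_span_range_vsub_right ℝ p 0]
  refine le_antisymm (Submodule.span_mono ?_) (Submodule.span_le.2 ?_)
  · rintro _ ⟨m, rfl⟩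
    exact ⟨m.succ, rfl⟩
  · rintro _ ⟨m, rfl⟩
    refine Fin.cases ?_ (fun m => ?_) m
    · simp
    · exact Submodule.subset_span ⟨m, rfl⟩

theorem dim_simplex_le (s : Affine.Simplex ℝ (Space d) k) : k ≤ d := by
  simpa only [finrank_direction, finrank_euclideanSpace_fin] using
    Submodule.finrank_le (direction s)

theorem IsGenericSimplex.finrank_orthogonal_inf (hy : IsGenericSimplex y s.points) {p ℓ : ℕ}
    (hp : 1 ≤ p) (hℓ : 1 ≤ ℓ) (hℓp : ℓ ≤ p) (i : Fin (ℓ + 1) ↪ Fin N)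
    (j : Fin (p + 1) ↪ Fin (k + 1)) :
    Module.finrank ℝ ((vectorSpan ℝ (range (y ∘ i)))ᗮ ⊓ vectorSpan ℝ (range (s.points ∘ j)) :
      Submodule ℝ (Space d)) = p - ℓ := by
  have hN : ℓ + 1 ≤ N := by simpa using Fintype.card_le_of_embedding i
  have hpk : p + 1 ≤ k + 1 := by simpa using Fintype.card_le_of_embedding j
  have hkd := dim_simplex_le s
  rw [← span_range_succ_sub_zero, ← span_range_succ_sub_zero]
  exact hy p hp (by omega) ℓ hℓ (le_min (by omega) (by omega)) i j

theorem IsGenericSimplex.notMem_orthogonal_face (hy : IsGenericSimplex y s.points) {p : ℕ}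
    (hp : 1 ≤ p) (e : Fin (p + 1) ↪ Fin (k + 1)) {i j : Fin N} (hij : i ≠ j) :
    y j - y i ∉ (vectorSpan ℝ (range (s.points ∘ e)))ᗮ := by
  intro h
  let pair : Fin 2 ↪ Fin N := ⟨![i, j], by
    intro m n
    fin_cases m <;> fin_cases n <;> simp [hij, hij.symm]⟩
  have hpair : vectorSpan ℝ (range (y ∘ pair)) ≤ (vectorSpan ℝ (range (s.points ∘ e)))ᗮ := by
    rw [← span_range_succ_sub_zero, Submodule.span_le]
    rintro _ ⟨m, rfl⟩
    fin_cases m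
    exact h
  have hrank := hy.finrank_orthogonal_inf hp le_rfl hp pair e
  rw [inf_eq_right.2 (Submodule.le_orthogonal_iff_le_orthogonal.1 hpair),
    (s.independent.comp_embedding e).finrank_vectorSpan (Fintype.card_fin _)] at hrank
  omega

theorem IsGenericSimplex.notMem_orthogonal_direction (hy : IsGenericSimplex y s.points)
    (hk : 2 ≤ k) {i j l : Fin N} (hij : i ≠ j) (hil : i ≠ l) (hjl : j ≠ l) (r : ℝ) :
    y l - y i - r • (y j - y i) ∉ (direction s)ᗮ := by
  intro h
  let pair : Fin 2 ↪ Fin N := ⟨![i, j], by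
    intro m n
    fin_cases m <;> fin_cases n <;> simp [hij, hij.symm]⟩
  let triple : Fin 3 ↪ Fin N := ⟨![i, j, l], by
    intro m n
    fin_cases m <;> fin_cases n <;> simp [hij, hij.symm, hil, hil.symm, hjl, hjl.symm]⟩
  have hj : y j - y i ∈ vectorSpan ℝ (range (y ∘ pair)) :=
    vsub_mem_vectorSpan ℝ ⟨1, rfl⟩ ⟨0, rfl⟩
  have htriple : vectorSpan ℝ (range (y ∘ triple)) ≤
      vectorSpan ℝ (range (y ∘ pair)) ⊔ (direction s)ᗮ := by
    rw [← span_range_succ_sub_zero, Submodule.span_le]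
    rintro _ ⟨m, rfl⟩
    fin_cases m
    · exact Submodule.mem_sup_left hj
    · exact Submodule.mem_sup.2 ⟨r • (y j - y i), Submodule.smul_mem _ r hj, _, h,
        add_sub_cancel _ _⟩
  have hle : (vectorSpan ℝ (range (y ∘ pair)))ᗮ ⊓ direction s ≤
      (vectorSpan ℝ (range (y ∘ triple)))ᗮ ⊓ direction s := by
    refine le_inf ?_ inf_le_right
    simpa only [← Submodule.inf_orthogonal, Submodule.orthogonal_orthogonal] using
      Submodule.orthogonal_le htriple
  -- The left side has dimension `k - 1`, the right side `k - 2`.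
  have hfinrank := Submodule.finrank_mono hle
  have hpair := hy.finrank_orthogonal_inf (by omega) le_rfl (by omega) pair (.refl (Fin (k + 1)))
  have htriple := hy.finrank_orthogonal_inf (by omega) one_le_two hk triple (.refl (Fin (k + 1)))
  change Module.finrank ℝ (_ ⊓ direction s : Submodule ℝ (Space d)) = _ at hpair htriple
  omega

theorem IsGenericSimplex.isTransverse (hy : IsGenericSimplex y s.points) (hk : 2 ≤ k) :
    IsTransverse y s where
  notMem_orthogonal_facet f i j hij := by
    obtain ⟨k, rfl⟩ : ∃ m, k = m + 1 := ⟨k - 1, by omega⟩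
    obtain ⟨k, rfl⟩ : ∃ m, k = m + 1 := ⟨k - 1, by omega⟩
    rw [← Fin.range_succAbove, ← range_comp]
    exact hy.notMem_orthogonal_face (by omega) f.succAboveEmb hij
  notMem_orthogonal_direction _ _ _ hij hil hjl r := hy.notMem_orthogonal_direction hk hij hil hjl r

end Transversality

section Cells

variable {d N k : ℕ} (s : Affine.Simplex ℝ (Space d) k) (y : Fin N → Space d) (i : Fin N)

/-- The normals of the half-spaces which cut out the power cell of `y i` inside a simplex, in the
chart of the simplex: those of the bisectors, followed by those of the facets. -/
def cellNormal : {j // j ≠ i} ⊕ Fin (k + 1) → direction s :=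
  Sum.elim (fun j => (2 : ℝ) • (direction s).orthogonalProjectionOnto (y j - y i)) (facetNormal s)

/-- The thresholds of the half-spaces bounded by the bisectors of `y i`, in the chart of a
simplex. -/
def bisectorThreshold (ψ : Fin N → ℝ) (j : {j // j ≠ i}) : ℝ :=
  ψ j - ψ i + (‖y j‖ ^ 2 - ‖y i‖ ^ 2 - 2 * ⟪y j - y i, s.points 0⟫)

/-- The thresholds of the half-spaces with normals `cellNormal s y i`. -/
def cellThreshold (ψ : Fin N → ℝ) : {j // j ≠ i} ⊕ Fin (k + 1) → ℝ :=
  Sum.elim (bisectorThreshold s y i ψ) fun f => (chartBasis s).coord f 0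

variable {s y i}

theorem norm_cellNormal_inl (j : {j // j ≠ i}) :
    ‖cellNormal s y i (.inl j)‖ = 2 * ‖(direction s).starProjection (y i - y j)‖ := by
  rw [cellNormal, Sum.elim_inl, norm_smul, Submodule.coe_norm, ← Submodule.starProjection_apply,
    ← neg_sub (y i), map_neg, norm_neg, Real.norm_ofNat]

theorem inner_cellNormal_inl (j : {j // j ≠ i}) (v : direction s) :
    ⟪cellNormal s y i (.inl j), v⟫ = 2 * ⟪y j - y i, (v : Space d)⟫ := by
  rw [cellNormal, Sum.elim_inl, real_inner_smul_left,
    Submodule.inner_orthogonalProjectionOnto_eq_of_mem_right]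

theorem inner_cellNormal_inl_sub_bisectorThreshold (ψ : Fin N → ℝ) (j : {j // j ≠ i})
    (v : direction s) :
    ⟪cellNormal s y i (.inl j), v⟫ - bisectorThreshold s y i ψ j =
      (‖chart s v - y i‖ ^ 2 + ψ i) - (‖chart s v - y j‖ ^ 2 + ψ j) := by
  rw [inner_cellNormal_inl, bisectorThreshold, chart_apply, norm_sub_sq_real, norm_sub_sq_real,
    real_inner_comm (y i), real_inner_comm (y j), inner_add_right, inner_add_right, inner_sub_left,
    inner_sub_left]
  ring

theorem mem_polyhedron_cellNormal_iff (ψ : Fin N → ℝ) (v : direction s) :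
    v ∈ polyhedron (cellNormal s y i) (cellThreshold s y i ψ) ↔
      chart s v ∈ powerCell y ψ i ∩ convexHull ℝ (range s.points) := by
  have hcell : (∀ j, ⟪cellNormal s y i (.inl j), v⟫ ≤ bisectorThreshold s y i ψ j) ↔
      chart s v ∈ powerCell y ψ i := by
    refine ⟨fun h j => ?_, fun h j => ?_⟩
    · rcases eq_or_ne j i with rfl | hj
      · exact le_rfl
      · exact sub_nonpos.1 (inner_cellNormal_inl_sub_bisectorThreshold ψ ⟨j, hj⟩ v ▸
          sub_nonpos.2 (h ⟨j, hj⟩))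
    · exact sub_nonpos.1 (inner_cellNormal_inl_sub_bisectorThreshold ψ j v ▸ sub_nonpos.2 (h j))
  rw [mem_inter_iff, ← hcell, convexHull_eq_image_chart, (chart s).injective.mem_set_image]
  exact Sum.forall

theorem powerCell_inter_convexHull (ψ : Fin N → ℝ) :
    powerCell y ψ i ∩ convexHull ℝ (range s.points) =
      chart s '' polyhedron (cellNormal s y i) (cellThreshold s y i ψ) := by
  rw [show polyhedron (cellNormal s y i) (cellThreshold s y i ψ) =
    chart s ⁻¹' (powerCell y ψ i ∩ convexHull ℝ (range s.points)) from
      ext (mem_polyhedron_cellNormal_iff ψ), image_preimage_eq_of_subset]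
  rw [convexHull_eq_image_chart]
  exact inter_subset_right.trans (image_subset_range _ _)

theorem mem_powerCell_iff_of_mem {ψ : Fin N → ℝ} {x : Space d} (hx : x ∈ powerCell y ψ i)
    (j : Fin N) : x ∈ powerCell y ψ j ↔ ‖x - y i‖ ^ 2 + ψ i = ‖x - y j‖ ^ 2 + ψ j :=
  ⟨fun h => le_antisymm (hx j) (h i), fun h l => h ▸ hx l⟩

theorem powerCell_inter_powerCell_inter_convexHull (ψ : Fin N → ℝ) (j : {j // j ≠ i}) :
    powerCell y ψ i ∩ powerCell y ψ j ∩ convexHull ℝ (range s.points) =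
      chart s '' face (cellNormal s y i) (cellThreshold s y i ψ) (.inl j) := by
  rw [inter_right_comm, powerCell_inter_convexHull, face, ← image_inter_preimage]
  congr 1
  ext v
  refine and_congr_right fun hv => ?_
  rw [mem_preimage, mem_powerCell_iff_of_mem ((mem_polyhedron_cellNormal_iff ψ v).1 hv).1,
    ← sub_eq_zero, ← inner_cellNormal_inl_sub_bisectorThreshold, sub_eq_zero]
  rfl

theorem IsTransverse.cellNormal_inl_ne_zero (hy : IsTransverse y s) (j : {j // j ≠ i}) :
    cellNormal s y i (.inl j) ≠ 0 := by
  rw [cellNormal, Sum.elim_inl, smul_ne_zero_iff_right two_ne_zero, Ne,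
    Submodule.orthogonalProjectionOnto_eq_zero_iff]
  exact fun h => hy.notMem_orthogonal_facet 0 i j j.2.symm
    (Submodule.orthogonal_le (vectorSpan_mono ℝ (image_subset_range _ _)) h)

theorem IsTransverse.starProjection_ne_zero (hy : IsTransverse y s) {i j : Fin N} (hij : i ≠ j) :
    (direction s).starProjection (y i - y j) ≠ 0 := by
  have h := norm_ne_zero_iff.2 (hy.cellNormal_inl_ne_zero ⟨j, hij.symm⟩)
  rw [norm_cellNormal_inl] at h
  exact norm_ne_zero_iff.1 (right_ne_zero_of_mul h)

theorem IsTransverse.facetNormal_notMem_span (hy : IsTransverse y s) (j : {j // j ≠ i})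
    (f : Fin (k + 1)) : facetNormal s f ∉ ℝ ∙ cellNormal s y i (.inl j) := by
  intro h
  obtain ⟨r, hr⟩ := Submodule.mem_span_singleton.1 h
  have hfacet := hy.notMem_orthogonal_facet f i j j.2.symm
  obtain ⟨m, hm⟩ : ({f}ᶜ : Set (Fin (k + 1))).Nonempty := by
    rw [nonempty_iff_ne_empty]
    intro hf
    simp [hf] at hfacet
  refine hfacet ((Submodule.mem_orthogonal' _ _).2 fun v hv => ?_)
  have hv' : v ∈ direction s := vectorSpan_mono ℝ (image_subset_range _ _) hv
  have hzero := inner_facetNormal_eq_zero (v := ⟨v, hv'⟩) hv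
  rw [← hr, real_inner_smul_left, inner_cellNormal_inl] at hzero
  have hr_ne : r ≠ 0 := by
    rintro rfl
    exact facetNormal_ne_zero hm (by rw [← hr, zero_smul])
  simpa [hr_ne] using hzero

theorem IsTransverse.cellNormal_notMem_span (hy : IsTransverse y s) (j : {j // j ≠ i})
    (l : {j // j ≠ i} ⊕ Fin (k + 1)) (hl : l ≠ .inl j) :
    cellNormal s y i l ∉ ℝ ∙ cellNormal s y i (.inl j) := by
  rcases l with l | f
  · intro h
    obtain ⟨r, hr⟩ := Submodule.mem_span_singleton.1 h
    have hjl : (j : Fin N) ≠ l := fun h => hl (congrArg Sum.inl (Subtype.ext h.symm))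
    refine hy.notMem_orthogonal_direction i j l j.2.symm l.2.symm hjl r ?_
    rw [cellNormal, Sum.elim_inl, Sum.elim_inl, smul_comm] at hr
    rw [← Submodule.orthogonalProjectionOnto_eq_zero_iff, map_sub, map_smul, sub_eq_zero]
    exact (smul_right_injective _ (two_ne_zero (α := ℝ)) hr).symm
  · exact hy.facetNormal_notMem_span j f

end Cells

section CellIntegrals

variable {d N k : ℕ} {s : Affine.Simplex ℝ (Space d) k} {y : Fin N → Space d}
  {ρ ρ' : Space d → ℝ} {i j : Fin N}

theorem isClosed_powerCell (y : Fin N → Space d) (ψ : Fin N → ℝ) (i : Fin N) :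
    IsClosed (powerCell y ψ i) := by
  simp only [powerCell, ofPred_forall]
  exact isClosed_iInter fun l => isClosed_le (by fun_prop) (by fun_prop)

theorem isCompact_convexHull_range (s : Affine.Simplex ℝ (Space d) k) :
    IsCompact (convexHull ℝ (range s.points)) :=
  (finite_range _).isCompact_convexHull ℝ

/-- The contribution of the simplex `s` to `interfaceMass`. -/
def simplexInterfaceMass (s : Affine.Simplex ℝ (Space d) k) (ρ : Space d → ℝ)
    (y : Fin N → Space d) (ψ : Fin N → ℝ) (i j : Fin N) : ℝ :=
  1 / (2 * ‖(direction s).starProjection (y i - y j)‖) *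
    ∫ x in powerCell y ψ i ∩ powerCell y ψ j ∩ convexHull ℝ (range s.points), ρ x ∂μHE[k - 1]

theorem simplexInterfaceMass_congr (h : EqOn ρ ρ' (convexHull ℝ (range s.points)))
    (ψ : Fin N → ℝ) : simplexInterfaceMass s ρ y ψ i j = simplexInterfaceMass s ρ' y ψ i j := by
  have hm := (((isClosed_powerCell y ψ i).inter (isClosed_powerCell y ψ j)).inter
    (isCompact_convexHull_range s).isClosed).measurableSet
  rw [simplexInterfaceMass, simplexInterfaceMass,
    setIntegral_congr_fun hm (h.mono inter_subset_right)]

theorem setIntegral_powerCell_eq (ρ : Space d → ℝ) (ψ : Fin N → ℝ) :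
    ∫ x in powerCell y ψ i ∩ convexHull ℝ (range s.points), ρ x ∂μHE[k] =
      ∫ v in polyhedron (cellNormal s y i) (cellThreshold s y i ψ), ρ (chart s v) := by
  rw [powerCell_inter_convexHull, setIntegral_image_euclideanHausdorffMeasure (chart s).isometry,
    euclideanHausdorffMeasure_direction]

theorem simplexInterfaceMass_eq (ρ : Space d → ℝ) (ψ : Fin N → ℝ) (j : {j // j ≠ i}) :
    simplexInterfaceMass s ρ y ψ i j = ‖cellNormal s y i (.inl j)‖⁻¹ •
      faceIntegral (cellNormal s y i) (ρ ∘ chart s) (.inl j) (cellThreshold s y i ψ) := by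
  rw [simplexInterfaceMass, powerCell_inter_powerCell_inter_convexHull,
    setIntegral_image_euclideanHausdorffMeasure (chart s).isometry, norm_cellNormal_inl,
    faceIntegral, finrank_direction, one_div, smul_eq_mul]
  rfl

theorem hasFDerivAt_bisectorThreshold (s : Affine.Simplex ℝ (Space d) k) (y : Fin N → Space d)
    (i : Fin N) (ψ : Fin N → ℝ) :
    HasFDerivAt (bisectorThreshold s y i)
      (ContinuousLinearMap.pi fun j : {j // j ≠ i} =>
        ContinuousLinearMap.proj (R := ℝ) (φ := fun _ : Fin N => ℝ) j.1 -
          ContinuousLinearMap.proj i) ψ :=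
  hasFDerivAt_pi.2 fun j =>
    ((hasFDerivAt_apply j.1 ψ).sub (hasFDerivAt_apply i ψ)).add_const _

theorem continuous_cellThreshold (s : Affine.Simplex ℝ (Space d) k) (y : Fin N → Space d)
    (i : Fin N) : Continuous (cellThreshold s y i) := by
  refine continuous_pi fun l => ?_
  rcases l with j | f
  · exact ((continuous_apply j.1).sub (continuous_apply i)).add continuous_const
  · exact continuous_const

namespace IsTransverse

variable (hy : IsTransverse y s)
include hy

theorem integrableOn_interface (hρ : ContinuousOn ρ (convexHull ℝ (range s.points))) (hij : i ≠ j)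
    (ψ : Fin N → ℝ) :
    IntegrableOn ρ (powerCell y ψ i ∩ powerCell y ψ j ∩ convexHull ℝ (range s.points))
      μHE[k - 1] := by
  obtain ⟨g, hg, hgs, hgρ⟩ := exists_hasCompactSupport_eqOn (isCompact_convexHull_range s) hρ
  have hm := (((isClosed_powerCell y ψ i).inter (isClosed_powerCell y ψ j)).inter
    (isCompact_convexHull_range s).isClosed).measurableSet
  refine (integrableOn_congr_fun (hgρ.mono inter_subset_right) hm).1 ?_
  have hchart := (chart s).isometry
  rw [powerCell_inter_powerCell_inter_convexHull ψ ⟨j, hij.symm⟩,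
    integrableOn_image_euclideanHausdorffMeasure hchart]
  have hint := integrableOn_hyperplane (hg.comp hchart.continuous)
    (hgs.comp_isClosedEmbedding hchart.isClosedEmbedding)
    (hy.cellNormal_inl_ne_zero ⟨j, hij.symm⟩) (cellThreshold s y i ψ (.inl ⟨j, hij.symm⟩))
  rw [finrank_direction] at hint
  exact hint.mono_set inter_subset_right

theorem continuous_simplexInterfaceMass (hρ : ContinuousOn ρ (convexHull ℝ (range s.points)))
    (hij : i ≠ j) : Continuous fun ψ => simplexInterfaceMass s ρ y ψ i j := by
  obtain ⟨g, hg, hgs, hgρ⟩ := exists_hasCompactSupport_eqOn (isCompact_convexHull_range s) hρ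
  have hchart := (chart s).isometry
  have hface := continuous_faceIntegral (hg.comp hchart.continuous)
    (hgs.comp_isClosedEmbedding hchart.isClosedEmbedding)
    (hy.cellNormal_inl_ne_zero ⟨j, hij.symm⟩) (hy.cellNormal_notMem_span ⟨j, hij.symm⟩)
  refine ((hface.comp (continuous_cellThreshold s y i)).const_smul
    ‖cellNormal s y i (.inl ⟨j, hij.symm⟩)‖⁻¹).congr fun ψ => ?_
  rw [← simplexInterfaceMass_congr hgρ]
  exact (simplexInterfaceMass_eq g ψ ⟨j, hij.symm⟩).symm

theorem hasFDerivAt_setIntegral_powerCell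
    (hρ : ContinuousOn ρ (convexHull ℝ (range s.points))) (i : Fin N) (ψ : Fin N → ℝ) :
    HasFDerivAt
      (fun ψ => ∫ x in powerCell y ψ i ∩ convexHull ℝ (range s.points), ρ x ∂μHE[k])
      (∑ j ∈ Finset.univ.erase i, simplexInterfaceMass s ρ y ψ i j •
        (ContinuousLinearMap.proj (R := ℝ) (φ := fun _ : Fin N => ℝ) j -
          ContinuousLinearMap.proj i)) ψ := by
  obtain ⟨g, hg, hgs, hgρ⟩ := exists_hasCompactSupport_eqOn (isCompact_convexHull_range s) hρ
  have hchart := (chart s).isometry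
  have hm (ψ : Fin N → ℝ) := ((isClosed_powerCell y ψ i).inter
    (isCompact_convexHull_range s).isClosed).measurableSet
  have hcongr (ψ : Fin N → ℝ) :=
    setIntegral_congr_fun (μ := μHE[k]) (hm ψ) (hgρ.mono inter_subset_right)
  simp only [← hcongr, setIntegral_powerCell_eq, ← simplexInterfaceMass_congr hgρ]
  have hderiv := (hasFDerivAt_setIntegral_polyhedron_sumElim (hg.comp hchart.continuous)
    (hgs.comp_isClosedEmbedding hchart.isClosedEmbedding)
    (hy.cellNormal_inl_ne_zero (i := i)) hy.cellNormal_notMem_span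
    (fun f => (chartBasis s).coord f 0) (bisectorThreshold s y i ψ)).comp ψ
      (hasFDerivAt_bisectorThreshold s y i ψ)
  refine hderiv.congr_fderiv ?_
  rw [Finset.sum_subtype (p := (· ≠ i)) (F := inferInstance) _ (by simp)]
  simp only [simplexInterfaceMass_eq]
  ext v
  simp [cellThreshold, mul_comm]

end IsTransverse

end CellIntegrals

section SimplicialMeasure

variable {ι : Type*} {d N : ℕ} {S : SimplexSoup ι d} {ρ : ι → Space d → ℝ}
  {μ : Measure (Space d)} {y : Fin N → Space d}

theorem lag_inter_body (S : SimplexSoup ι d) (y : Fin N → Space d) (ψ : Fin N → ℝ) (i : Fin N)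
    (a : ι) : lag S y ψ i ∩ S.body a = powerCell y ψ i ∩ S.body a := by
  have hsub : S.body a ⊆ S.support := subset_iUnion S.body a
  rw [lag, inter_assoc, inter_eq_right.2 hsub]

theorem lagInter_inter_body (S : SimplexSoup ι d) (y : Fin N → Space d) (ψ : Fin N → ℝ)
    (i j : Fin N) (a : ι) :
    lagInter S y ψ i j ∩ S.body a = powerCell y ψ i ∩ powerCell y ψ j ∩ S.body a := by
  rw [lagInter, inter_inter_distrib_right, lag_inter_body, lag_inter_body,
    ← inter_inter_distrib_right]

theorem measurableSet_lag [Countable ι] (S : SimplexSoup ι d) (y : Fin N → Space d)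
    (ψ : Fin N → ℝ) (i : Fin N) : MeasurableSet (lag S y ψ i) :=
  (isClosed_powerCell y ψ i).measurableSet.inter
    (.iUnion fun a => (isCompact_convexHull_range (S.simplex a)).measurableSet)

variable [Fintype ι]

theorem interfaceMass_eq_sum (S : SimplexSoup ι d) (ρ : ι → Space d → ℝ) (y : Fin N → Space d)
    (ψ : Fin N → ℝ) (i j : Fin N) :
    interfaceMass S ρ y ψ i j = ∑ a, simplexInterfaceMass (S.simplex a) (ρ a) y ψ i j := by
  simp only [interfaceMass, lagInter_inter_body]
  rfl

theorem continuous_interfaceMass (hρ : ∀ a, ContinuousOn (ρ a) (S.body a))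
    (hy : ∀ a, IsTransverse y (S.simplex a)) {i j : Fin N} (hij : i ≠ j) :
    Continuous fun ψ => interfaceMass S ρ y ψ i j := by
  simp only [interfaceMass_eq_sum]
  exact continuous_finsetSum _ fun a _ => (hy a).continuous_simplexInterfaceMass (hρ a) hij

namespace IsSimplicialMeasure

variable (hμ : IsSimplicialMeasure S ρ μ) (hρ : ∀ a, ContinuousOn (ρ a) (S.body a))
include hμ hρ

theorem measure_eq {B : Set (Space d)} (hB : MeasurableSet B) :
    μ B = ∑ a, ENNReal.ofReal (∫ x in B ∩ S.body a, ρ a x ∂μHE[S.dim a]) := by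
  rw [hμ.apply_eq B hB]
  refine Finset.sum_congr rfl fun a _ => (ofReal_integral_eq_lintegral_ofReal ?_ ?_).symm
  · exact (integrableOn_convexHull (hρ a)).mono_set inter_subset_right
  · exact ae_restrict_of_forall_mem
      (hB.inter (isCompact_convexHull_range (S.simplex a)).measurableSet)
      fun x hx => hμ.density_nonneg a x hx.2

theorem isFiniteMeasure : IsFiniteMeasure μ where
  measure_univ_lt_top := by
    rw [hμ.measure_eq hρ .univ]
    exact ENNReal.sum_lt_top.2 fun a _ => ENNReal.ofReal_lt_top

theorem massMap_eq (y : Fin N → Space d) (ψ : Fin N → ℝ) (i : Fin N) :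
    massMap S μ y ψ i = ∑ a, ∫ x in powerCell y ψ i ∩ S.body a, ρ a x ∂μHE[S.dim a] := by
  rw [massMap, hμ.measure_eq hρ (measurableSet_lag S y ψ i),
    ENNReal.toReal_sum fun a _ => ENNReal.ofReal_ne_top]
  refine Finset.sum_congr rfl fun a _ => ?_
  rw [lag_inter_body, ENNReal.toReal_ofReal]
  exact setIntegral_nonneg ((isClosed_powerCell y ψ i).inter
    (isCompact_convexHull_range (S.simplex a)).isClosed).measurableSet
      fun x hx => hμ.density_nonneg a x hx.2

variable (hy : ∀ a, IsTransverse y (S.simplex a))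
include hy

theorem hasFDerivAt_massMap_apply (ψ : Fin N → ℝ) (i : Fin N) :
    HasFDerivAt (fun ψ => massMap S μ y ψ i)
      (∑ j ∈ Finset.univ.erase i, interfaceMass S ρ y ψ i j •
        (ContinuousLinearMap.proj (R := ℝ) (φ := fun _ : Fin N => ℝ) j -
          ContinuousLinearMap.proj i)) ψ := by
  simp only [hμ.massMap_eq hρ, interfaceMass_eq_sum, Finset.sum_smul]
  rw [Finset.sum_comm]
  exact HasFDerivAt.fun_sum fun a _ => (hy a).hasFDerivAt_setIntegral_powerCell (hρ a) i ψ

theorem contDiff_massMap : ContDiff ℝ 1 (massMap S μ y) := by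
  refine contDiff_pi.2 fun i => contDiff_one_iff_hasFDerivAt.2
    ⟨_, ?_, fun ψ => hμ.hasFDerivAt_massMap_apply hρ hy ψ i⟩
  exact continuous_finsetSum _ fun j hj =>
    (continuous_interfaceMass hρ hy (Finset.ne_of_mem_erase hj).symm).smul continuous_const

theorem hasDerivAt_massMap_update (ψ : Fin N → ℝ) (i j : Fin N) :
    HasDerivAt (fun t => massMap S μ y (Function.update ψ j t) i)
      (∑ l ∈ Finset.univ.erase i, interfaceMass S ρ y ψ i l *
        (Pi.single (M := fun _ => ℝ) j 1 l - Pi.single (M := fun _ => ℝ) j 1 i)) (ψ j) := by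
  have hmass := hμ.hasFDerivAt_massMap_apply hρ hy ψ i
  rw [← Function.update_eq_self j ψ] at hmass
  refine (hmass.comp_hasDerivAt (ψ j) (hasDerivAt_update ψ j (ψ j))).congr_deriv ?_
  simp

theorem hasDerivAt_massMap_update_of_ne (ψ : Fin N → ℝ) {i j : Fin N} (hij : i ≠ j) :
    HasDerivAt (fun t => massMap S μ y (Function.update ψ j t) i)
      (interfaceMass S ρ y ψ i j) (ψ j) := by
  refine (hμ.hasDerivAt_massMap_update hρ hy ψ i j).congr_deriv ?_
  simp [Pi.single_apply, hij, hij.symm]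

theorem hasDerivAt_massMap_update_self (ψ : Fin N → ℝ) (i : Fin N) :
    HasDerivAt (fun t => massMap S μ y (Function.update ψ i t) i)
      (-∑ j ∈ Finset.univ.erase i, interfaceMass S ρ y ψ i j) (ψ i) := by
  refine (hμ.hasDerivAt_massMap_update hρ hy ψ i i).congr_deriv ?_
  rw [← Finset.sum_neg_distrib]
  refine Finset.sum_congr rfl fun j hj => ?_
  simp [Finset.ne_of_mem_erase hj]

end IsSimplicialMeasure

end SimplicialMeasure

theorem mainTheorem2_general {ι : Type*} [Fintype ι] {d N : ℕ} (S : SimplexSoup ι d)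
    (ρ : ι → Space d → ℝ) (μ : Measure (Space d)) (y : Fin N → Space d)
    (hμ : IsSimplicialMeasure S ρ μ) (hρ : ∀ a, ContinuousOn (ρ a) (S.body a))
    (hy : ∀ a, IsTransverse y (S.simplex a)) :
    IsFiniteMeasure μ ∧
    ContDiff ℝ 1 (massMap S μ y) ∧
    (∀ (ψ : Fin N → ℝ) (i j : Fin N), i ≠ j →
      (∀ a, (S.tangent a).starProjection (y i - y j) ≠ 0) ∧
      (∀ a, IntegrableOn (ρ a) (lagInter S y ψ i j ∩ S.body a) μHE[S.dim a - 1]) ∧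
      HasDerivAt (fun t : ℝ => massMap S μ y (Function.update ψ j t) i)
        (interfaceMass S ρ y ψ i j) (ψ j)) ∧
    (∀ (ψ : Fin N → ℝ) (i : Fin N),
      HasDerivAt (fun t : ℝ => massMap S μ y (Function.update ψ i t) i)
        (-∑ j ∈ Finset.univ.erase i, interfaceMass S ρ y ψ i j) (ψ i)) := by
  refine ⟨hμ.isFiniteMeasure hρ, hμ.contDiff_massMap hρ hy, fun ψ i j hij =>
    ⟨fun a => (hy a).starProjection_ne_zero hij, fun a => ?_,
      hμ.hasDerivAt_massMap_update_of_ne hρ hy ψ hij⟩,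
    fun ψ i => hμ.hasDerivAt_massMap_update_self hρ hy ψ i⟩
  rw [lagInter_inter_body]
  exact (hy a).integrableOn_interface (hρ a) hij ψ

end SemiDiscrete

end

theorem mainTheorem2 {ι : Type*} [Fintype ι] {d N : ℕ}
    (S : SemiDiscrete.SimplexSoup ι d) (ρ : ι → SemiDiscrete.Space d → ℝ)
    (μ : Measure (SemiDiscrete.Space d)) (y : Fin N → SemiDiscrete.Space d)
    (hμ : SemiDiscrete.IsRegularSimplicialMeasure S ρ μ)
    (hy : SemiDiscrete.IsGeneric y S) :
    -- the masses are finite and the map `G` is of class `C¹` on all of `ℝ^N`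
    IsFiniteMeasure μ ∧
    ContDiff ℝ 1 (SemiDiscrete.massMap S μ y) ∧
    -- the off-diagonal partial derivatives; no factor is a division by zero,
    -- and all the integrals converge
    (∀ (ψ : Fin N → ℝ) (i j : Fin N), i ≠ j →
      (∀ a, (S.tangent a).starProjection (y i - y j) ≠ 0) ∧
      (∀ a, IntegrableOn (ρ a) (SemiDiscrete.lagInter S y ψ i j ∩ S.body a) μHE[S.dim a - 1]) ∧
      HasDerivAt (fun t : ℝ => SemiDiscrete.massMap S μ y (Function.update ψ j t) i)
        (SemiDiscrete.interfaceMass S ρ y ψ i j) (ψ j)) ∧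
    -- the diagonal partial derivatives
    (∀ (ψ : Fin N → ℝ) (i : Fin N),
      HasDerivAt (fun t : ℝ => SemiDiscrete.massMap S μ y (Function.update ψ i t) i)
        (-∑ j ∈ Finset.univ.erase i, SemiDiscrete.interfaceMass S ρ y ψ i j) (ψ i)) :=
  SemiDiscrete.mainTheorem2_general S ρ μ y hμ.toIsSimplicialMeasure hμ.density_continuous
    fun a => (hy a).isTransverse (hμ.two_le_dim a)
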